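/- **Setting.** Let $(M,g_M)$ be a smooth finite-dimensional Riemannian manifold with Levi-Civita connection $\nabla$, carrying a hyperkähler structure $(I,J,K,g_M)$: $I,J,K$ are smooth sections of $\mathrm{End}(TM)$ on $M$ with $I^2=J^2=K^2=-\mathrm{id}$, $IJ=-JI=K$, and for each $R\in\{I,J,K\}$ one has $g_M(RX,RY)=g_M(X,Y)$ for all $X,Y$ and $\nabla R=0$. Let $(N,g_N)$ be a smooth finite-dimensional Riemannian manifold and let $F:M\to N$ be a horizontally conformal submersion, i.e. $F$ is smooth and for every $p\in M$ the differential $(F_*)_p$ is surjective and there is a number $\lambda(p)>0$ with $g_N(F_*X,F_*Y)=\lambda(p)^2 g_M(X,Y)$ for all $X,Y\in(\ker (F_*)_p)^\perp$. Assume that $F$ is an almost h-conformal slant submersion with $(I,J,K)$ as almost h-conformal slant basis, i.e. for each $R\in\{I,J,K\}$ there is a constant $\theta_R$, the slant angle of $R$, such that for every $q\in M$ and every nonzero $X\in\ker (F_*)_q$ the angle between $RX$ and the subspace $\ker (F_*)_q$ equals $\theta_R$. Let $\mathcal V$ and $\mathcal H$ be the orthogonal projections of $TM$ onto $\ker F_*$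 and $(\ker F_*)^\perp$. For $R\in\{I,J,K\}$ and $V\in\Gamma(\ker F_*)$ put $\omega_R V=\mathcal H(RV)$, and call $\omega_R$ *parallel* if $$(\nabla_V\omega_R)(W):=\mathcal H\nabla_V(\omega_R W)-\omega_R(\mathcal V\nabla_V W)=0\qquad\text{for all } V,W\in\Gamma(\ker F_*).$$ **Theorem.** Suppose that for some $R\in\{I,J,K\}$ the map $\omega_R$ is parallel and the slant angle satisfies $0\le\theta_R<\frac{\pi}{2}$. Then every fiber of $F$ is a minimal submanifold of $M$: its mean curvature vector $\frac1m\sum_{i=1}^m \mathcal T_{e_i}e_i$ vanishes at every point, where $m$ is the dimension of the fiber, $(e_i)$ is an orthonormal basis of its tangent space $\ker F_*$, and $\mathcal T_VW=\mathcal H\nabla_VW$ $(V,W\in\Gamma(\ker F_*))$ is its second fundamental form. -/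

import Mathlib

open Bundle Manifold FiberBundle
open scoped ContDiff InnerProductSpace

noncomputable section

namespace HConformalSlant

variable {E : Type*} [NormedAddCommGroup E] [NormedSpace ℝ E] [FiniteDimensional ℝ E]
  {M : Type*} [TopologicalSpace M] [ChartedSpace E M]

set_option linter.unusedSectionVars false

instance tangentSpace_finiteDimensional (p : M) :
    FiniteDimensional ℝ (TangentSpace 𝓘(ℝ, E) p) :=
  inferInstanceAs (FiniteDimensional ℝ E)

section LeviCivita

variable [RiemannianBundle (fun x : M ↦ TangentSpace 𝓘(ℝ, E) x)]

/-- The derivative of the function `g(Y, Z)` at `p`. -/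
def dInner (Y Z : Π x : M, TangentSpace 𝓘(ℝ, E) x) (p : M) : TangentSpace 𝓘(ℝ, E) p →L[ℝ] ℝ :=
  mvfderiv 𝓘(ℝ, E) (fun x ↦ ⟪Y x, Z x⟫_ℝ) p

/-- The right-hand side of the Koszul formula, which equals `2 g(∇_X Y, Z)` at `p`. -/
def koszul (X Y Z : Π x : M, TangentSpace 𝓘(ℝ, E) x) (p : M) : ℝ :=
  dInner Y Z p (X p) + dInner Z X p (Y p) - dInner X Y p (Z p)
    + ⟪VectorField.mlieBracket 𝓘(ℝ, E) X Y p, Z p⟫_ℝ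
    - ⟪VectorField.mlieBracket 𝓘(ℝ, E) X Z p, Y p⟫_ℝ
    - ⟪VectorField.mlieBracket 𝓘(ℝ, E) Y Z p, X p⟫_ℝ

theorem dInner_symm (Y Z : Π x : M, TangentSpace 𝓘(ℝ, E) x) (p : M) :
    dInner Y Z p = dInner Z Y p := by
  simp only [dInner, real_inner_comm]

variable [IsManifold 𝓘(ℝ, E) ∞ M]
  [IsContMDiffRiemannianBundle 𝓘(ℝ, E) ∞ E (fun x : M ↦ TangentSpace 𝓘(ℝ, E) x)]

theorem mdifferentiableAt_inner {Y Z : Π x : M, TangentSpace 𝓘(ℝ, E) x} {p : M}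
    (hY : MDiffAt (T% Y) p) (hZ : MDiffAt (T% Z) p) :
    MDifferentiableAt 𝓘(ℝ, E) 𝓘(ℝ, ℝ) (fun x ↦ ⟪Y x, Z x⟫_ℝ) p :=
  MDifferentiableAt.inner_bundle (E := fun x : M ↦ TangentSpace 𝓘(ℝ, E) x) hY hZ

theorem dInner_add_right {Y Z Z' : Π x : M, TangentSpace 𝓘(ℝ, E) x} {p : M}
    (hY : MDiffAt (T% Y) p) (hZ : MDiffAt (T% Z) p) (hZ' : MDiffAt (T% Z') p) :
    dInner Y (Z + Z') p = dInner Y Z p + dInner Y Z' p := by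
  simp only [dInner, Pi.add_apply, inner_add_right]
  exact mvfderiv_fun_add (mdifferentiableAt_inner hY hZ) (mdifferentiableAt_inner hY hZ')

theorem dInner_smul_right {Y Z : Π x : M, TangentSpace 𝓘(ℝ, E) x} {f : M → ℝ} {p : M}
    (hf : MDiffAt f p) (hY : MDiffAt (T% Y) p) (hZ : MDiffAt (T% Z) p) :
    dInner Y (f • Z) p = f p • dInner Y Z p + ⟪Y p, Z p⟫_ℝ • mvfderiv 𝓘(ℝ, E) f p := by
  simp only [dInner, Pi.smul_apply', inner_smul_right]
  exact mvfderiv_fun_mul hf (mdifferentiableAt_inner hY hZ)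

theorem dInner_add_left {Y Z Z' : Π x : M, TangentSpace 𝓘(ℝ, E) x} {p : M}
    (hY : MDiffAt (T% Y) p) (hZ : MDiffAt (T% Z) p) (hZ' : MDiffAt (T% Z') p) :
    dInner (Z + Z') Y p = dInner Z Y p + dInner Z' Y p := by
  rw [dInner_symm, dInner_add_right hY hZ hZ', dInner_symm Y Z, dInner_symm Y Z']

theorem dInner_smul_left {Y Z : Π x : M, TangentSpace 𝓘(ℝ, E) x} {f : M → ℝ} {p : M}
    (hf : MDiffAt f p) (hY : MDiffAt (T% Y) p) (hZ : MDiffAt (T% Z) p) :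
    dInner (f • Z) Y p = f p • dInner Z Y p + ⟪Y p, Z p⟫_ℝ • mvfderiv 𝓘(ℝ, E) f p := by
  rw [dInner_symm, dInner_smul_right hf hY hZ, dInner_symm Y Z]

theorem koszul_tensorial_left (Y Z : Π x : M, TangentSpace 𝓘(ℝ, E) x) (p : M)
    (hY : MDiffAt (T% Y) p) (hZ : MDiffAt (T% Z) p) :
    TensorialAt 𝓘(ℝ, E) E (fun X ↦ koszul X Y Z p) p where
  smul {f X} hf hX := by
    simp only [koszul, dInner_smul_right hf hZ hX, dInner_smul_left hf hY hX,
      VectorField.mlieBracket_smul_left hf hX, Pi.smul_apply']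
    simp [inner_add_left, inner_smul_left, inner_smul_right, real_inner_comm]
    ring
  add {X X'} hX hX' := by
    simp only [koszul, dInner_add_right hZ hX hX', dInner_add_left hY hX hX',
      VectorField.mlieBracket_add_left hX hX', Pi.add_apply]
    simp [inner_add_left, inner_add_right]
    ring

theorem koszul_tensorial_right (X Y : Π x : M, TangentSpace 𝓘(ℝ, E) x) (p : M)
    (hX : MDiffAt (T% X) p) (hY : MDiffAt (T% Y) p) :
    TensorialAt 𝓘(ℝ, E) E (fun Z ↦ koszul X Y Z p) p where
  smul {f Z} hf hZ := by
    simp only [koszul, dInner_smul_right hf hY hZ, dInner_smul_left hf hX hZ,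
      VectorField.mlieBracket_smul_right hf hZ, Pi.smul_apply']
    simp [inner_add_left, inner_smul_left, inner_smul_right, real_inner_comm]
    ring
  add {Z Z'} hZ hZ' := by
    simp only [koszul, dInner_add_right hY hZ hZ', dInner_add_left hX hZ hZ',
      VectorField.mlieBracket_add_right hZ hZ', Pi.add_apply]
    simp [inner_add_left, inner_add_right]
    ring

theorem koszul_add_middle {X Y Y' Z : Π x : M, TangentSpace 𝓘(ℝ, E) x} {p : M}
    (hX : MDiffAt (T% X) p) (hY : MDiffAt (T% Y) p) (hY' : MDiffAt (T% Y') p)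
    (hZ : MDiffAt (T% Z) p) :
    koszul X (Y + Y') Z p = koszul X Y Z p + koszul X Y' Z p := by
  simp only [koszul, dInner_add_left hZ hY hY', dInner_add_right hX hY hY', Pi.add_apply,
    VectorField.mlieBracket_add_right hY hY', VectorField.mlieBracket_add_left hY hY']
  simp [inner_add_left, inner_add_right]
  ring

theorem koszul_smul_middle {X Y Z : Π x : M, TangentSpace 𝓘(ℝ, E) x} {f : M → ℝ} {p : M}
    (hX : MDiffAt (T% X) p) (hY : MDiffAt (T% Y) p) (hf : MDiffAt f p)
    (hZ : MDiffAt (T% Z) p) :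
    koszul X (f • Y) Z p
      = f p * koszul X Y Z p + 2 * (mvfderiv 𝓘(ℝ, E) f p (X p) * ⟪Y p, Z p⟫_ℝ) := by
  simp only [koszul, dInner_smul_left hf hZ hY, dInner_smul_right hf hX hY, Pi.smul_apply',
    VectorField.mlieBracket_smul_right hf hY, VectorField.mlieBracket_smul_left hf hY]
  simp [inner_add_left, inner_smul_left, inner_smul_right, real_inner_comm]
  ring

open Classical in
/-- The Levi-Civita connection as a function: for `Y` differentiable at `p`, the vector
`leviCivitaFun Y p v` (that is, `∇_v Y`) is characterized by
`2 g(∇_{X} Y, Z) = koszul X Y Z` at `p`; if `Y` is not differentiable at `p`, the value is `0`. -/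
def leviCivitaFun (Y : Π x : M, TangentSpace 𝓘(ℝ, E) x) (p : M) :
    TangentSpace 𝓘(ℝ, E) p →L[ℝ] TangentSpace 𝓘(ℝ, E) p :=
  if hY : MDiffAt (T% Y) p then
    LinearMap.toContinuousLinearMap
      { toFun := fun v ↦ (2⁻¹ : ℝ) • (InnerProductSpace.toDual ℝ (TangentSpace 𝓘(ℝ, E) p)).symm
          (TensorialAt.mkHom₂ (I := 𝓘(ℝ, E)) (F := E) (F' := E) (fun X Z ↦ koszul X Y Z p) p
            (fun Z hZ ↦ koszul_tensorial_left Y Z p hY hZ)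
            (fun X hX ↦ koszul_tensorial_right X Y p hX hY) v)
        map_add' := fun v w ↦ by simp
        map_smul' := fun c v ↦ by simp [smul_comm c] }
  else 0

theorem inner_leviCivitaFun {X Y Z : Π x : M, TangentSpace 𝓘(ℝ, E) x} {p : M}
    (hX : MDiffAt (T% X) p) (hY : MDiffAt (T% Y) p) (hZ : MDiffAt (T% Z) p) :
    ⟪leviCivitaFun Y p (X p), Z p⟫_ℝ = 2⁻¹ * koszul X Y Z p := by
  simp only [leviCivitaFun, dif_pos hY, LinearMap.coe_toContinuousLinearMap', LinearMap.coe_mk,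
    AddHom.coe_mk, real_inner_smul_left, InnerProductSpace.toDual_symm_apply]
  rw [TensorialAt.mkHom₂_apply (I := 𝓘(ℝ, E)) (F := E) (F' := E)
    (Φ := fun X Z ↦ koszul X Y Z p) _ _ hX hZ]

/-- Two tangent vectors `a`, `b` at `p` agree as soon as their inner products with the value at `p`
of every differentiable vector field do. -/
theorem ext_inner_field {p : M} {a b : TangentSpace 𝓘(ℝ, E) p}
    (h : ∀ Z : Π x : M, TangentSpace 𝓘(ℝ, E) x, MDiffAt (T% Z) p → ⟪a, Z p⟫_ℝ = ⟪b, Z p⟫_ℝ) :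
    a = b := by
  refine ext_inner_right ℝ fun z ↦ ?_
  have := h (extend E z) (mdifferentiableAt_extend ..)
  simpa using this

theorem isCovariantDerivativeOn_leviCivitaFun :
    IsCovariantDerivativeOn (I := 𝓘(ℝ, E)) (M := M) E leviCivitaFun Set.univ where
  add {Y Y' p} hY hY' _ := by
    ext v
    refine ext_inner_field fun Z hZ ↦ ?_
    have hX := mdifferentiableAt_extend 𝓘(ℝ, E) E v
    have h1 := inner_leviCivitaFun hX hY hZ
    have h2 := inner_leviCivitaFun hX hY' hZ
    have h3 := inner_leviCivitaFun hX (mdifferentiableAt_add_section hY hY') hZ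
    rw [koszul_add_middle hX hY hY' hZ] at h3
    rw [extend_apply_self] at h1 h2 h3
    rw [add_apply, inner_add_left, h1, h2, h3]
    ring
  leibniz {Y f p} hY hf _ := by
    ext v
    refine ext_inner_field fun Z hZ ↦ ?_
    have hX := mdifferentiableAt_extend 𝓘(ℝ, E) E v
    have h1 := inner_leviCivitaFun hX hY hZ
    have h3 := inner_leviCivitaFun hX (hf.smul_section hY) hZ
    rw [koszul_smul_middle hX hY hf hZ] at h3
    rw [extend_apply_self] at h1 h3
    simp only [add_apply, smul_apply,
      ContinuousLinearMap.smulRight_apply, inner_add_left, real_inner_smul_left, h1, h3]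
    ring

variable (E M) in
/-- The Levi-Civita connection of the Riemannian metric of `M`; `leviCivita E M Y p v` is
`∇_v Y` at `p`. -/
def leviCivita : CovariantDerivative 𝓘(ℝ, E) E (fun x : M ↦ TangentSpace 𝓘(ℝ, E) x) :=
  ⟨leviCivitaFun, isCovariantDerivativeOn_leviCivitaFun⟩

/-- `∇` is torsion-free. -/
theorem leviCivita_torsion_free {X Y : Π x : M, TangentSpace 𝓘(ℝ, E) x} {p : M}
    (hX : MDiffAt (T% X) p) (hY : MDiffAt (T% Y) p) :
    leviCivita E M Y p (X p) - leviCivita E M X p (Y p)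
      = VectorField.mlieBracket 𝓘(ℝ, E) X Y p := by
  refine ext_inner_field fun Z hZ ↦ ?_
  have h1 : ⟪leviCivita E M Y p (X p), Z p⟫_ℝ = _ := inner_leviCivitaFun hX hY hZ
  have h2 : ⟪leviCivita E M X p (Y p), Z p⟫_ℝ = _ := inner_leviCivitaFun hY hX hZ
  rw [inner_sub_left, h1, h2, koszul, koszul, dInner_symm Z X, dInner_symm Z Y, dInner_symm Y X,
    VectorField.mlieBracket_swap_apply (V := Y) (W := X), inner_neg_left]
  ring

/-- `∇` is compatible with the metric. -/
theorem leviCivita_metric {X Y Z : Π x : M, TangentSpace 𝓘(ℝ, E) x} {p : M}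
    (hX : MDiffAt (T% X) p) (hY : MDiffAt (T% Y) p) (hZ : MDiffAt (T% Z) p) :
    mvfderiv 𝓘(ℝ, E) (fun x ↦ ⟪Y x, Z x⟫_ℝ) p (X p)
      = ⟪leviCivita E M Y p (X p), Z p⟫_ℝ + ⟪Y p, leviCivita E M Z p (X p)⟫_ℝ := by
  have h1 : ⟪leviCivita E M Y p (X p), Z p⟫_ℝ = _ := inner_leviCivitaFun hX hY hZ
  have h2 : ⟪leviCivita E M Z p (X p), Y p⟫_ℝ = _ := inner_leviCivitaFun hX hZ hY
  rw [real_inner_comm (leviCivita E M Z p (X p)) (Y p), h1, h2, koszul, koszul, dInner_symm Z X, dInner_symm Z Y, dInner_symm Y X,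
    VectorField.mlieBracket_swap_apply (V := Z) (W := Y), inner_neg_left]
  change dInner Y Z p (X p) = _
  ring

end LeviCivita

section Hyperkahler

variable [IsManifold 𝓘(ℝ, E) ∞ M]
  [RiemannianBundle (fun x : M ↦ TangentSpace 𝓘(ℝ, E) x)]

/-- Fields of endomorphisms of the tangent bundle. -/
abbrev EndField (E : Type*) [NormedAddCommGroup E] [NormedSpace ℝ E]
    (M : Type*) [TopologicalSpace M] [ChartedSpace E M] : Type _ :=
  Π x : M, TangentSpace 𝓘(ℝ, E) x →L[ℝ] TangentSpace 𝓘(ℝ, E) x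

/-- `R` is a smooth section of `End(TM)`. -/
def IsSmoothEndField (R : EndField E M) : Prop :=
  ContMDiff 𝓘(ℝ, E) (𝓘(ℝ, E).prod 𝓘(ℝ, E →L[ℝ] E)) ∞
    (fun x ↦ TotalSpace.mk' (E →L[ℝ] E)
      (E := fun x : M ↦ TangentSpace 𝓘(ℝ, E) x →L[ℝ] TangentSpace 𝓘(ℝ, E) x) x (R x))

/-- `R` is an almost complex structure for which the metric is Hermitian. -/
structure IsAlmostHermitian (R : EndField E M) : Prop where
  smooth : IsSmoothEndField R
  sq_eq_neg : ∀ (p : M) (v : TangentSpace 𝓘(ℝ, E) p), R p (R p v) = -v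
  inner_eq : ∀ (p : M) (v w : TangentSpace 𝓘(ℝ, E) p), ⟪R p v, R p w⟫_ℝ = ⟪v, w⟫_ℝ

variable [IsContMDiffRiemannianBundle 𝓘(ℝ, E) ∞ E (fun x : M ↦ TangentSpace 𝓘(ℝ, E) x)]

/-- `∇R = 0`, that is, `∇_v (R Y) = R (∇_v Y)` for all `Y`. -/
def IsParallelEndField (R : EndField E M) : Prop :=
  ∀ (Y : Π x : M, TangentSpace 𝓘(ℝ, E) x) (p : M), MDiffAt (T% Y) p →
    ∀ v : TangentSpace 𝓘(ℝ, E) p,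
      leviCivita E M (fun x ↦ R x (Y x)) p v = R p (leviCivita E M Y p v)

variable (E M) in
/-- A hyperkähler structure `(I, J, K, g)` on the Riemannian manifold `(M, g)`: a global quaternionic
Hermitian basis whose members are parallel for the Levi-Civita connection. -/
structure HyperkahlerStructure where
  I : EndField E M
  J : EndField E M
  K : EndField E M
  hermitian : ∀ R ∈ ({I, J, K} : Set (EndField E M)), IsAlmostHermitian R
  I_J : ∀ (p : M) (v : TangentSpace 𝓘(ℝ, E) p), I p (J p v) = K p v
  J_I : ∀ (p : M) (v : TangentSpace 𝓘(ℝ, E) p), J p (I p v) = -K p v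
  parallel : ∀ R ∈ ({I, J, K} : Set (EndField E M)), IsParallelEndField R

/-- The set `{I, J, K}`. -/
def HyperkahlerStructure.basis (S : HyperkahlerStructure E M) : Set (EndField E M) :=
  {S.I, S.J, S.K}

end Hyperkahler

section Submersion

variable {E' : Type*} [NormedAddCommGroup E'] [NormedSpace ℝ E']
  {N : Type*} [TopologicalSpace N] [ChartedSpace E' N]

variable (E E') in
/-- The vertical space `ker (F_*)_p`. -/
def vertical (F : M → N) (p : M) : Submodule ℝ (TangentSpace 𝓘(ℝ, E) p) :=
  LinearMap.ker (mfderiv 𝓘(ℝ, E) 𝓘(ℝ, E') F p).toLinearMap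

variable [RiemannianBundle (fun x : M ↦ TangentSpace 𝓘(ℝ, E) x)]

variable (E E') in
/-- The orthogonal projection `𝒱` of `T_p M` onto `ker (F_*)_p`. -/
def vProj (F : M → N) (p : M) : TangentSpace 𝓘(ℝ, E) p →L[ℝ] TangentSpace 𝓘(ℝ, E) p :=
  (vertical E E' F p).starProjection

variable (E E') in
/-- The orthogonal projection `ℋ` of `T_p M` onto `(ker (F_*)_p)ᗮ`. -/
def hProj (F : M → N) (p : M) : TangentSpace 𝓘(ℝ, E) p →L[ℝ] TangentSpace 𝓘(ℝ, E) p :=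
  (vertical E E' F p)ᗮ.starProjection

variable (E E') in
/-- `F` is a horizontally conformal submersion: it is smooth, every `(F_*)_p` is surjective, and
`(F_*)_p` multiplies the inner product of horizontal vectors by `λ(p)²` for some `λ(p) > 0`. -/
structure IsHorizontallyConformalSubmersion
    [RiemannianBundle (fun x : N ↦ TangentSpace 𝓘(ℝ, E') x)] (F : M → N) : Prop where
  smooth : ContMDiff 𝓘(ℝ, E) 𝓘(ℝ, E') ∞ F
  surjective : ∀ p, Function.Surjective (mfderiv 𝓘(ℝ, E) 𝓘(ℝ, E') F p)
  conformal : ∀ p, ∃ dil : ℝ, 0 < dil ∧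
    ∀ X ∈ (vertical E E' F p)ᗮ, ∀ Y ∈ (vertical E E' F p)ᗮ,
      ⟪mfderiv 𝓘(ℝ, E) 𝓘(ℝ, E') F p X, mfderiv 𝓘(ℝ, E) 𝓘(ℝ, E') F p Y⟫_ℝ
        = dil ^ 2 * ⟪X, Y⟫_ℝ

variable (E E') in
/-- `θ` is the slant angle of `R`: for every point `q` and every nonzero `X ∈ ker (F_*)_q`, the angle
between `R X` and the space `ker (F_*)_q` is `θ`. The angle between a nonzero vector and a subspace
is its angle with its orthogonal projection to the subspace (`π / 2` if the projection is zero). -/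
def HasSlantAngle (F : M → N) (R : EndField E M) (θ : ℝ) : Prop :=
  ∀ (q : M), ∀ X ∈ vertical E E' F q, X ≠ 0 →
    InnerProductGeometry.angle (R q X) (vProj E E' F q (R q X)) = θ

/-- A smooth vector field on `M` that is a section of `ker F_*`. -/
structure IsVerticalField (E' : Type*) [NormedAddCommGroup E'] [NormedSpace ℝ E']
    {N : Type*} [TopologicalSpace N] [ChartedSpace E' N] (F : M → N)
    [IsManifold 𝓘(ℝ, E) 1 M]
    (V : Π x : M, TangentSpace 𝓘(ℝ, E) x) : Prop where
  smooth : ContMDiff 𝓘(ℝ, E) (𝓘(ℝ, E).prod 𝓘(ℝ, E)) ∞ (T% V)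
  mem_vertical : ∀ x, V x ∈ vertical E E' F x

variable (E') in
/-- `ω_R V`, the horizontal part of `R V`, for vertical `V`. -/
def omega (F : M → N) (R : EndField E M) (p : M) (v : TangentSpace 𝓘(ℝ, E) p) :
    TangentSpace 𝓘(ℝ, E) p :=
  hProj E E' F p (R p v)

variable [IsManifold 𝓘(ℝ, E) ∞ M]
  [IsContMDiffRiemannianBundle 𝓘(ℝ, E) ∞ E (fun x : M ↦ TangentSpace 𝓘(ℝ, E) x)]

variable (E') in
/-- `(∇_V ω_R)(W) = ℋ ∇_V (ω_R W) - ω_R (𝒱 ∇_V W)` at `p`. -/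
def nablaOmega (F : M → N) (R : EndField E M) (V W : Π x : M, TangentSpace 𝓘(ℝ, E) x) (p : M) :
    TangentSpace 𝓘(ℝ, E) p :=
  hProj E E' F p (leviCivita E M (fun x ↦ omega E' F R x (W x)) p (V p))
    - omega E' F R p (vProj E E' F p (leviCivita E M W p (V p)))

variable (E') in
/-- `ω_R` is parallel: `(∇_V ω_R)(W) = 0` for all `V, W ∈ Γ(ker F_*)`. -/
def IsOmegaParallel (F : M → N) (R : EndField E M) : Prop :=
  ∀ V W : Π x : M, TangentSpace 𝓘(ℝ, E) x,
    IsVerticalField E' F V → IsVerticalField E' F W → ∀ p, nablaOmega E' F R V W p = 0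

/-- `F` is an almost h-conformal slant submersion from the hyperkähler manifold `(M, I, J, K, g)` and
`(I, J, K)` is an almost h-conformal slant basis (on all of `M`). -/
structure IsAlmostHConformalSlant (E' : Type*) [NormedAddCommGroup E'] [NormedSpace ℝ E']
    {N : Type*} [TopologicalSpace N] [ChartedSpace E' N]
    [RiemannianBundle (fun x : N ↦ TangentSpace 𝓘(ℝ, E') x)]
    (S : HyperkahlerStructure E M) (F : M → N) : Prop where
  horizontallyConformal : IsHorizontallyConformalSubmersion E E' F
  slant : ∀ R ∈ S.basis, ∃ θ : ℝ, HasSlantAngle E E' F R θ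

variable (E') in
/-- O'Neill's tensor `𝒯_X Y = ℋ ∇_{𝒱 X} 𝒱 Y + 𝒱 ∇_{𝒱 X} ℋ Y` at `p`. -/
def oneillT (F : M → N) (X Y : Π x : M, TangentSpace 𝓘(ℝ, E) x) (p : M) :
    TangentSpace 𝓘(ℝ, E) p :=
  hProj E E' F p (leviCivita E M (fun x ↦ vProj E E' F x (Y x)) p (vProj E E' F p (X p)))
    + vProj E E' F p (leviCivita E M (fun x ↦ hProj E E' F x (Y x)) p (vProj E E' F p (X p)))

variable (E E') in
/-- The second fundamental form at `p` of the fiber through `p`. Its tangent space at `p` is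
`ker (F_*)_p`, and for `v, w` in it the value is `𝒯_v w`, the normal part of the derivative `∇_v W`
of a vector field `W` tangent to the fibers with `W p = w`; as such a field serves `𝒱` applied to
a vector field that extends `w`. -/
def fiberSecondFundamentalForm (F : M → N) (p : M) (v w : vertical E E' F p) :
    TangentSpace 𝓘(ℝ, E) p :=
  oneillT E' F (extend E (v : TangentSpace 𝓘(ℝ, E) p)) (extend E (w : TangentSpace 𝓘(ℝ, E) p)) p

variable (E E') in
/-- The mean curvature vector at `p` of the fiber through `p`: the trace of the second fundamental
form divided by the dimension of the fiber. -/
def fiberMeanCurvature (F : M → N) (p : M) : TangentSpace 𝓘(ℝ, E) p :=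
  (Module.finrank ℝ (vertical E E' F p) : ℝ)⁻¹ •
    ∑ i, fiberSecondFundamentalForm E E' F p
      (stdOrthonormalBasis ℝ (vertical E E' F p) i) (stdOrthonormalBasis ℝ (vertical E E' F p) i)

variable (E E') in
/-- The fiber of `F` over `q` is minimal: its mean curvature vector vanishes at each of its points. -/
def IsMinimalFiber (F : M → N) (q : N) : Prop :=
  ∀ p ∈ F ⁻¹' {q}, fiberMeanCurvature E E' F p = 0

end Submersion

end HConformalSlant

end

open HConformalSlant

open scoped Topology

/-! Write `T` for the second fundamental form of the fibers and split `R W = φ W + ω W` into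
vertical and horizontal parts for vertical `W`. Since `∇R = 0`, the horizontal part of `∇_V (R W) =
R ∇_V W`, combined with the parallelism of `ω`, gives `T_v (φ w) = ℋ R (T_v w)`
(`IsOmegaParallel.fiberSecondFundamentalForm_verticalPart`). Symmetry of `T` then lets `φ` change
slots: `T_{φv} φv = ℋ R T_{φv} v = ℋ R T_v φv = T_v φ²v`. The slant condition and skew-adjointness
of `R` give `φ² = -cos² θ` and `‖φ v‖ = cos θ ‖v‖`, with `cos θ > 0`. So `φ / cos θ` is an isometry
of the vertical space that reverses the sign of the quadratic form `T_v v`. The trace of `T` equals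
its own negative and vanishes (`sum_inner_eq_zero_of_norm_map`).

The remaining work is analytic: `𝒱` preserves smoothness of fields (`contMDiffAt_vProj`), so
vertical vectors extend to vertical fields, and brackets of vertical fields are vertical
(`mlieBracket_mem_vertical`), which makes `T` symmetric. -/

namespace HConformalSlant

/-! ### Orthogonal projection to a kernel as the solution of a linear system. -/

section SaddlePoint

open ContinuousLinearMap

variable {E E' : Type*} [NormedAddCommGroup E] [NormedSpace ℝ E]
  [NormedAddCommGroup E'] [NormedSpace ℝ E']

theorem finrank_dual_eq [FiniteDimensional ℝ E] :
    Module.finrank ℝ (E →L[ℝ] ℝ) = Module.finrank ℝ E := by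
  rw [← (LinearMap.toContinuousLinearMap (𝕜 := ℝ) (E := E) (F' := ℝ)).finrank_eq]
  exact Subspace.dual_finrank_eq

/-- The operator `(u, l) ↦ (G u + l ∘ A, A u)` of the saddle point problem that computes the
`G`-orthogonal projection to the kernel of `A`. -/
noncomputable def saddleOperator (G : E →L[ℝ] E →L[ℝ] ℝ) (A : E →L[ℝ] E') :
    (E × (E' →L[ℝ] ℝ)) →L[ℝ] ((E →L[ℝ] ℝ) × E') :=
  (inl ℝ (E →L[ℝ] ℝ) E').comp (G.comp (fst ℝ E (E' →L[ℝ] ℝ)) +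
    ((compL ℝ E E' ℝ).flip A).comp (snd ℝ E (E' →L[ℝ] ℝ))) +
  (inr ℝ (E →L[ℝ] ℝ) E').comp (A.comp (fst ℝ E (E' →L[ℝ] ℝ)))

@[simp]
theorem saddleOperator_apply (G : E →L[ℝ] E →L[ℝ] ℝ) (A : E →L[ℝ] E') (u : E) (l : E' →L[ℝ] ℝ) :
    saddleOperator G A (u, l) = (G u + l.comp A, A u) := by
  simp [saddleOperator]

set_option synthInstance.maxHeartbeats 400000 in
theorem contDiff_saddleOperator {n : ℕ∞ω} :
    ContDiff ℝ n (fun B : (E →L[ℝ] E →L[ℝ] ℝ) × (E →L[ℝ] E') ↦ saddleOperator B.1 B.2) := by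
  unfold saddleOperator
  have h : ContDiff ℝ n (fun B : (E →L[ℝ] E →L[ℝ] ℝ) × (E →L[ℝ] E') ↦
      (compL ℝ E E' ℝ).flip B.2) :=
    contDiff_const.clm_apply contDiff_snd
  exact (contDiff_const.clm_comp ((contDiff_fst.clm_comp contDiff_const).add
    (h.clm_comp contDiff_const))).add
      (contDiff_const.clm_comp (contDiff_snd.clm_comp contDiff_const))

variable [FiniteDimensional ℝ E] [FiniteDimensional ℝ E']

/-- If `A u = 0` and `G u + l ∘ A = 0`, evaluation at `u` removes the `l` term, so `G u u = 0` and
`u = 0`; then `l ∘ A = 0` with `A` onto forces `l = 0`. Equal dimensions do the rest. -/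
theorem saddleOperator_isInvertible {G : E →L[ℝ] E →L[ℝ] ℝ} {A : E →L[ℝ] E'}
    (hG : ∀ u, G u u = 0 → u = 0) (hA : Function.Surjective A) :
    (saddleOperator G A).IsInvertible := by
  have hinj : Function.Injective (saddleOperator G A) := by
    rw [injective_iff_map_eq_zero]
    rintro ⟨u, l⟩ h
    rw [saddleOperator_apply, Prod.mk_eq_zero] at h
    have hu : u = 0 := hG u (by simpa [h.2] using DFunLike.congr_fun h.1 u)
    subst hu
    have hl : l = 0 := by
      ext y
      obtain ⟨x, rfl⟩ := hA y
      simpa using DFunLike.congr_fun h.1 x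
    simp [hl]
  have hdim : Module.finrank ℝ (E × (E' →L[ℝ] ℝ)) = Module.finrank ℝ ((E →L[ℝ] ℝ) × E') := by
    rw [Module.finrank_prod, Module.finrank_prod, finrank_dual_eq, finrank_dual_eq]
  refine ⟨(LinearEquiv.ofInjectiveOfFinrankEq (saddleOperator G A).toLinearMap hinj
    hdim).toContinuousLinearEquiv, ?_⟩
  ext x <;> rfl

end SaddlePoint

/-! ### The metric and the differential of `F` in fixed trivializations. -/

section Coordinates

open ContinuousLinearMap

variable {E : Type*} [NormedAddCommGroup E] [NormedSpace ℝ E]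
  {M : Type*} [TopologicalSpace M] [ChartedSpace E M] [IsManifold 𝓘(ℝ, E) ∞ M]
  [RiemannianBundle (fun x : M ↦ TangentSpace 𝓘(ℝ, E) x)]
  [IsContMDiffRiemannianBundle 𝓘(ℝ, E) ∞ E (fun x : M ↦ TangentSpace 𝓘(ℝ, E) x)]

theorem exists_contMDiffAt_metric_coordinates (p : M) :
    ∃ G : M → E →L[ℝ] E →L[ℝ] ℝ, ContMDiffAt 𝓘(ℝ, E) 𝓘(ℝ, E →L[ℝ] E →L[ℝ] ℝ) ∞ G p ∧
      ∀ᶠ x in 𝓝 p, ∀ u v : TangentSpace 𝓘(ℝ, E) x,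
        G x (trivializationAt E (TangentSpace 𝓘(ℝ, E)) p ⟨x, u⟩).2
          (trivializationAt E (TangentSpace 𝓘(ℝ, E)) p ⟨x, v⟩).2 = ⟪u, v⟫_ℝ := by
  obtain ⟨g, hg, hgi⟩ := IsContMDiffRiemannianBundle.exists_contMDiff (IB := 𝓘(ℝ, E)) (n := ∞)
    (F := E) (E := fun x : M ↦ TangentSpace 𝓘(ℝ, E) x)
  have h := (contMDiffAt_totalSpace.1 (hg p)).2
  refine ⟨_, h, ?_⟩
  have hb := (trivializationAt E (TangentSpace 𝓘(ℝ, E)) p).open_baseSet.mem_nhds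
    (mem_baseSet_trivializationAt E (TangentSpace 𝓘(ℝ, E)) p)
  filter_upwards [hb] with x hx u v
  rw [hom_trivializationAt_apply, inCoordinates_apply_eq₂ hx hx (Set.mem_univ _), hgi,
    Trivialization.symm_apply_apply_mk _ hx, Trivialization.symm_apply_apply_mk _ hx]
  change (Trivialization.linearMapAt ℝ (trivializationAt ℝ (Bundle.Trivial M ℝ) p) x) (g x u v) = _
  simp

omit [RiemannianBundle (fun x : M ↦ TangentSpace 𝓘(ℝ, E) x)]
  [IsContMDiffRiemannianBundle 𝓘(ℝ, E) ∞ E (fun x : M ↦ TangentSpace 𝓘(ℝ, E) x)] in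
theorem exists_contMDiffAt_mfderiv_coordinates
    {E' : Type*} [NormedAddCommGroup E'] [NormedSpace ℝ E']
    {N : Type*} [TopologicalSpace N] [ChartedSpace E' N] [IsManifold 𝓘(ℝ, E') ∞ N]
    {F : M → N} (hF : ContMDiff 𝓘(ℝ, E) 𝓘(ℝ, E') ∞ F) (p : M) :
    ∃ A : M → E →L[ℝ] E', ContMDiffAt 𝓘(ℝ, E) 𝓘(ℝ, E →L[ℝ] E') ∞ A p ∧
      ∀ᶠ x in 𝓝 p, ∀ u : TangentSpace 𝓘(ℝ, E) x,
        A x (trivializationAt E (TangentSpace 𝓘(ℝ, E)) p ⟨x, u⟩).2 =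
          (trivializationAt E' (TangentSpace 𝓘(ℝ, E')) (F p)
            ⟨F x, mfderiv 𝓘(ℝ, E) 𝓘(ℝ, E') F x u⟩).2 := by
  refine ⟨_, (hF p).mfderiv_const (m := ∞) (by simp), ?_⟩
  have hb := (trivializationAt E (TangentSpace 𝓘(ℝ, E)) p).open_baseSet.mem_nhds
    (mem_baseSet_trivializationAt E (TangentSpace 𝓘(ℝ, E)) p)
  have hb' := hF.continuous.continuousAt.preimage_mem_nhds
    ((trivializationAt E' (TangentSpace 𝓘(ℝ, E')) (F p)).open_baseSet.mem_nhds
    (mem_baseSet_trivializationAt E' (TangentSpace 𝓘(ℝ, E')) (F p)))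
  filter_upwards [hb, hb'] with x hx hx' u
  have h := inCoordinates_eq (F := E) (E := fun x : M ↦ TangentSpace 𝓘(ℝ, E) x) (F' := E')
    (E' := fun x : N ↦ TangentSpace 𝓘(ℝ, E') x)
    (ϕ := (mfderiv 𝓘(ℝ, E) 𝓘(ℝ, E') F x)) (y₀ := F p) hx hx'
  refine (DFunLike.congr_fun h _).trans ?_
  simp [Trivialization.symm_apply_apply_mk _ hx]

omit [IsManifold 𝓘(ℝ, E) ∞ M] [RiemannianBundle (fun x : M ↦ TangentSpace 𝓘(ℝ, E) x)]
  [IsContMDiffRiemannianBundle 𝓘(ℝ, E) ∞ E (fun x : M ↦ TangentSpace 𝓘(ℝ, E) x)] in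
-- Inversion of operators is smooth at invertible ones, so the solution of the system depends
-- smoothly on its coefficients; no smooth frame of the kernels is needed.
theorem contMDiffAt_saddlePoint [FiniteDimensional ℝ E]
    {E' : Type*} [NormedAddCommGroup E'] [NormedSpace ℝ E'] [FiniteDimensional ℝ E']
    {G : M → E →L[ℝ] E →L[ℝ] ℝ} {A : M → E →L[ℝ] E'} {y : M → E} {p : M}
    (hG : ContMDiffAt 𝓘(ℝ, E) 𝓘(ℝ, E →L[ℝ] E →L[ℝ] ℝ) ∞ G p)
    (hA : ContMDiffAt 𝓘(ℝ, E) 𝓘(ℝ, E →L[ℝ] E') ∞ A p)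
    (hy : ContMDiffAt 𝓘(ℝ, E) 𝓘(ℝ, E) ∞ y p)
    (hinv : (saddleOperator (G p) (A p)).IsInvertible) :
    ContMDiffAt 𝓘(ℝ, E) 𝓘(ℝ, E) ∞
      (fun x ↦ ((saddleOperator (G x) (A x)).inverse (G x (y x), 0)).1) p := by
  have hL : ContMDiffAt 𝓘(ℝ, E) 𝓘(ℝ, (E × (E' →L[ℝ] ℝ)) →L[ℝ] ((E →L[ℝ] ℝ) × E')) ∞
      (fun x ↦ saddleOperator (G x) (A x)) p :=
    ContDiffAt.comp_contMDiffAt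
      (g := fun B : (E →L[ℝ] E →L[ℝ] ℝ) × (E →L[ℝ] E') ↦ saddleOperator B.1 B.2)
      (f := fun x ↦ (G x, A x)) contDiff_saddleOperator.contDiffAt (hG.prodMk_space hA)
  have hLi := (hinv.contDiffAt_map_inverse (𝕜 := ℝ) (n := ∞)).contMDiffAt.comp p hL
  exact (contMDiffAt_const (c := fst ℝ E (E' →L[ℝ] ℝ))).clm_apply
    (hLi.clm_apply ((hG.clm_apply hy).prodMk_space contMDiffAt_const))

end Coordinates

/-! ### Smoothness of the vertical projection. -/

section Projection

open ContinuousLinearMap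

variable {E : Type*} [NormedAddCommGroup E] [NormedSpace ℝ E] [FiniteDimensional ℝ E]
  {M : Type*} [TopologicalSpace M] [ChartedSpace E M] [IsManifold 𝓘(ℝ, E) ∞ M]
  [RiemannianBundle (fun x : M ↦ TangentSpace 𝓘(ℝ, E) x)]
  [IsContMDiffRiemannianBundle 𝓘(ℝ, E) ∞ E (fun x : M ↦ TangentSpace 𝓘(ℝ, E) x)]
  {E' : Type*} [NormedAddCommGroup E'] [NormedSpace ℝ E'] [FiniteDimensional ℝ E']
  {N : Type*} [TopologicalSpace N] [ChartedSpace E' N] [IsManifold 𝓘(ℝ, E') ∞ N]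
  {F : M → N}

/-- For a submersion, the vertical part of a smooth vector field is smooth. -/
theorem contMDiffAt_vProj (hF : ContMDiff 𝓘(ℝ, E) 𝓘(ℝ, E') ∞ F)
    (hsurj : ∀ p, Function.Surjective (mfderiv 𝓘(ℝ, E) 𝓘(ℝ, E') F p))
    {Y : Π x : M, TangentSpace 𝓘(ℝ, E) x} {p : M}
    (hY : ContMDiffAt 𝓘(ℝ, E) (𝓘(ℝ, E).prod 𝓘(ℝ, E)) ∞ (T% Y) p) :
    ContMDiffAt 𝓘(ℝ, E) (𝓘(ℝ, E).prod 𝓘(ℝ, E)) ∞ (T% (fun x ↦ vProj E E' F x (Y x))) p := by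
  obtain ⟨G, hG, hGi⟩ := exists_contMDiffAt_metric_coordinates (E := E) p
  obtain ⟨A, hA, hAi⟩ := exists_contMDiffAt_mfderiv_coordinates hF p
  set t := trivializationAt E (TangentSpace 𝓘(ℝ, E)) p
  set t' := trivializationAt E' (TangentSpace 𝓘(ℝ, E')) (F p)
  have hb : t.baseSet ∈ 𝓝 p := t.open_baseSet.mem_nhds
    (mem_baseSet_trivializationAt E (TangentSpace 𝓘(ℝ, E)) p)
  have hb' := hF.continuous.continuousAt.preimage_mem_nhds (t'.open_baseSet.mem_nhds
    (mem_baseSet_trivializationAt E' (TangentSpace 𝓘(ℝ, E')) (F p)))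
  rw [contMDiffAt_section] at hY ⊢
  have hinv : ∀ᶠ x in 𝓝 p, (saddleOperator (G x) (A x)).IsInvertible := by
    filter_upwards [hb, hb', hGi, hAi] with x hx hx' hGx hAx
    let e := t.continuousLinearEquivAt ℝ x hx
    let e' := t'.continuousLinearEquivAt ℝ (F x) hx'
    have hGe : ∀ u v, G x (e u) (e v) = ⟪u, v⟫_ℝ := hGx
    have hAe : ∀ u, A x (e u) = e' (mfderiv 𝓘(ℝ, E) 𝓘(ℝ, E') F x u) := hAx
    refine saddleOperator_isInvertible (fun u hu ↦ ?_) (fun y ↦ ?_)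
    · have h := hGe (e.symm u) (e.symm u)
      rw [e.apply_symm_apply, hu] at h
      exact e.symm.map_eq_zero_iff.1 (inner_self_eq_zero.1 h.symm)
    · obtain ⟨u, hu⟩ := hsurj x (e'.symm y)
      exact ⟨e u, by rw [hAe, hu, e'.apply_symm_apply]⟩
  have key : ∀ᶠ x in 𝓝 p, (t ⟨x, vProj E E' F x (Y x)⟩).2 =
      ((saddleOperator (G x) (A x)).inverse (G x (t ⟨x, Y x⟩).2, 0)).1 := by
    filter_upwards [hb, hb', hGi, hAi, hinv] with x hx hx' hGx hAx hix
    let e := t.continuousLinearEquivAt ℝ x hx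
    let e' := t'.continuousLinearEquivAt ℝ (F x) hx'
    have hGe : ∀ u v, G x (e u) (e v) = ⟪u, v⟫_ℝ := hGx
    have hAe : ∀ u, A x (e u) = e' (mfderiv 𝓘(ℝ, E) 𝓘(ℝ, E') F x u) := hAx
    change e (vProj E E' F x (Y x)) =
      ((saddleOperator (G x) (A x)).inverse (G x (e (Y x)), 0)).1
    obtain ⟨z, hz⟩ : ∃ z, (saddleOperator (G x) (A x)).inverse (G x (e (Y x)), 0) = z := ⟨_, rfl⟩
    have hz' : saddleOperator (G x) (A x) z = (G x (e (Y x)), 0) := by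
      rw [← hz, hix.self_apply_inverse]
    obtain ⟨u, l⟩ := z
    rw [hz]
    rw [saddleOperator_apply, Prod.mk.injEq] at hz'
    obtain ⟨w, rfl⟩ := e.surjective u
    congr 1
    -- The second equation of the system says that `w` is vertical. The first, tested on a vertical
    -- `v`, loses its `l ∘ A` term and says that `Y x - w` is orthogonal to `v`.
    refine Submodule.eq_starProjection_of_mem_of_inner_eq_zero ?_ (fun v hv ↦ ?_)
    · have h := hz'.2
      rw [hAe] at h
      exact e'.map_eq_zero_iff.1 h
    · have h := DFunLike.congr_fun hz'.1 (e v)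
      have hv0 : mfderiv 𝓘(ℝ, E) 𝓘(ℝ, E') F x v = 0 := hv
      simp only [add_apply, comp_apply, hAe, hGe, hv0, map_zero, add_zero] at h
      rw [inner_sub_left, h, sub_self]
  refine ContMDiffAt.congr_of_eventuallyEq ?_ key
  exact contMDiffAt_saddlePoint hG hA hY hinv.self_of_nhds

end Projection

/-! ### Brackets of fields annihilated by a differential. -/

open VectorField in
-- Differentiating `Df(U) = 0` along `v` gives `Df(DU v) = -D²f(v, U)`. In the bracket the two
-- second-derivative terms cancel by symmetry of `D²f`.
theorem fderiv_lieBracket_eq_zero {E E' : Type*} [NormedAddCommGroup E] [NormedSpace ℝ E]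
    [NormedAddCommGroup E'] [NormedSpace ℝ E'] {f : E → E'} {V W : E → E} {y : E}
    (hf : ContDiffAt ℝ 2 f y) (hV : DifferentiableAt ℝ V y) (hW : DifferentiableAt ℝ W y)
    (hfV : ∀ᶠ x in 𝓝 y, fderiv ℝ f x (V x) = 0) (hfW : ∀ᶠ x in 𝓝 y, fderiv ℝ f x (W x) = 0) :
    fderiv ℝ f y (lieBracket ℝ V W y) = 0 := by
  have hd : DifferentiableAt ℝ (fderiv ℝ f) y :=
    (hf.fderiv_right (m := 1) (by norm_num)).differentiableAt one_ne_zero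
  have key {U : E → E} (hU : DifferentiableAt ℝ U y)
      (hfU : ∀ᶠ x in 𝓝 y, fderiv ℝ f x (U x) = 0) (v : E) :
      fderiv ℝ f y (fderiv ℝ U y v) = -fderiv ℝ (fderiv ℝ f) y v (U y) := by
    have h := (hd.hasFDerivAt.clm_apply hU.hasFDerivAt).fderiv
    have h0 : fderiv ℝ (fun x ↦ fderiv ℝ f x (U x)) y = 0 := by
      rw [Filter.EventuallyEq.fderiv_eq (f := fun _ ↦ (0 : E')) hfU]
      simp
    have h1 := DFunLike.congr_fun (h.symm.trans h0) v
    simp at h1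
    exact eq_neg_of_add_eq_zero_left h1
  have hsymm := hf.isSymmSndFDerivAt (by simp)
  rw [lieBracket, map_sub, key hW hfW, key hV hfV, hsymm (V y) (W y)]
  simp

section Bracket

variable {E : Type*} [NormedAddCommGroup E] [NormedSpace ℝ E] [CompleteSpace E]
  {M : Type*} [TopologicalSpace M] [ChartedSpace E M] [IsManifold 𝓘(ℝ, E) ∞ M]

open VectorField in
-- The bracket on `M` is the bracket of the fields pulled back to the chart at `p`, so the vector
-- space case applies to `f ∘ φ.symm`.
theorem mfderiv_mlieBracket_eq_zero {E' : Type*} [NormedAddCommGroup E'] [NormedSpace ℝ E']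
    {f : M → E'} {V W : Π x : M, TangentSpace 𝓘(ℝ, E) x} {p : M}
    (hf : ContMDiffAt 𝓘(ℝ, E) 𝓘(ℝ, E') 2 f p)
    (hV : MDiffAt (T% V) p) (hW : MDiffAt (T% W) p)
    (hfV : ∀ᶠ x in 𝓝 p, mfderiv 𝓘(ℝ, E) 𝓘(ℝ, E') f x (V x) = 0)
    (hfW : ∀ᶠ x in 𝓝 p, mfderiv 𝓘(ℝ, E) 𝓘(ℝ, E') f x (W x) = 0) :
    mfderiv 𝓘(ℝ, E) 𝓘(ℝ, E') f p (mlieBracket 𝓘(ℝ, E) V W p) = 0 := by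
  set φ := extChartAt 𝓘(ℝ, E) p
  have hrange : Set.range 𝓘(ℝ, E) = Set.univ := by simp
  have htarget : φ.target ∈ 𝓝 (φ p) := extChartAt_target_mem_nhds p
  have hsymm : Filter.Tendsto φ.symm (𝓝 (φ p)) (𝓝 p) := by
    have h := continuousAt_extChartAt_symm (I := 𝓘(ℝ, E)) p
    rwa [ContinuousAt, extChartAt_to_inv] at h
  have hfd : ∀ᶠ x in 𝓝 p, MDifferentiableAt 𝓘(ℝ, E) 𝓘(ℝ, E') f x :=
    (contMDiffAt_iff_contMDiffAt_nhds (by simp)).1 hf |>.mono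
      fun x hx ↦ hx.mdifferentiableAt (by simp)
  have hderiv : ∀ᶠ y in 𝓝 (φ p), fderiv ℝ (f ∘ φ.symm) y =
      (mfderiv 𝓘(ℝ, E) 𝓘(ℝ, E') f (φ.symm y)).comp
        (mfderivWithin 𝓘(ℝ, E) 𝓘(ℝ, E) φ.symm (Set.range 𝓘(ℝ, E)) y) := by
    filter_upwards [htarget, hsymm.eventually hfd] with y hy hfy
    have h := mdifferentiableWithinAt_extChartAt_symm hy
    rw [hrange, mdifferentiableWithinAt_univ] at h
    rw [hrange, mfderivWithin_univ, ← mfderiv_comp _ hfy h, mfderiv_eq_fderiv]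
  have hpull {U : Π x : M, TangentSpace 𝓘(ℝ, E) x}
      (hfU : ∀ᶠ x in 𝓝 p, mfderiv 𝓘(ℝ, E) 𝓘(ℝ, E') f x (U x) = 0) :
      ∀ᶠ y in 𝓝 (φ p), fderiv ℝ (f ∘ φ.symm) y
        (mpullbackWithin 𝓘(ℝ, E) 𝓘(ℝ, E) φ.symm U (Set.range 𝓘(ℝ, E)) y) = 0 := by
    filter_upwards [hderiv, htarget, hsymm.eventually hfU] with y hy hyt hUy
    refine (DFunLike.congr_fun hy _).trans ?_
    change mfderiv 𝓘(ℝ, E) 𝓘(ℝ, E') f (φ.symm y)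
      (mfderivWithin 𝓘(ℝ, E) 𝓘(ℝ, E) φ.symm (Set.range 𝓘(ℝ, E)) y
        ((mfderivWithin 𝓘(ℝ, E) 𝓘(ℝ, E) φ.symm (Set.range 𝓘(ℝ, E)) y).inverse
          (U (φ.symm y)))) = 0
    rw [(isInvertible_mfderivWithin_extChartAt_symm hyt).self_apply_inverse, hUy]
  have hdiff {U : Π x : M, TangentSpace 𝓘(ℝ, E) x} (hU : MDiffAt (T% U) p) :
      DifferentiableAt ℝ
        (mpullbackWithin 𝓘(ℝ, E) 𝓘(ℝ, E) φ.symm U (Set.range 𝓘(ℝ, E))) (φ p) := by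
    rw [← mdifferentiableWithinAt_univ] at hU
    have h := hU.differentiableWithinAt_mpullbackWithin_vectorField
    exact h.differentiableAt (by simp)
  have hf2 : ContDiffAt ℝ 2 (f ∘ φ.symm) (φ p) := by
    have h := contMDiffWithinAt_extChartAt_symm_range (I := 𝓘(ℝ, E)) (n := 2) p
      (mem_extChartAt_target p)
    rw [hrange, contMDiffWithinAt_univ] at h
    refine ContMDiffAt.contDiffAt (ContMDiffAt.comp _ ?_ h)
    rwa [extChartAt_to_inv]
  have hlb (A B : E → E) (y : E) :
      lieBracketWithin ℝ A B (Set.range 𝓘(ℝ, E)) y = lieBracket ℝ A B y := by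
    rw [hrange, lieBracketWithin_univ]
  have h := (congrArg (fderiv ℝ (f ∘ φ.symm) (φ p)) (hlb _ _ (φ p))).trans <|
    fderiv_lieBracket_eq_zero hf2 (hdiff hV) (hdiff hW) (hpull hfV) (hpull hfW)
  have h' := (DFunLike.congr_fun hderiv.self_of_nhds _).symm.trans h
  rw [← mlieBracketWithin_univ, mlieBracketWithin_apply, Set.preimage_univ, Set.univ_inter]
  set L := lieBracketWithin ℝ (mpullbackWithin 𝓘(ℝ, E) 𝓘(ℝ, E) φ.symm V (Set.range 𝓘(ℝ, E)))
    (mpullbackWithin 𝓘(ℝ, E) 𝓘(ℝ, E) φ.symm W (Set.range 𝓘(ℝ, E))) (Set.range 𝓘(ℝ, E)) (φ p)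
  have hp : p ∈ φ.source := mem_extChartAt_source p
  -- The chain rule produces the derivative of `φ.symm`, the bracket the inverse of the derivative
  -- of `φ`; they agree at `p`.
  have hinv : mfderivWithin 𝓘(ℝ, E) 𝓘(ℝ, E) φ.symm (Set.range 𝓘(ℝ, E)) (φ p) L =
      (mfderiv 𝓘(ℝ, E) 𝓘(ℝ, E) φ p).inverse L := by
    obtain ⟨l, hl⟩ := (isInvertible_mfderiv_extChartAt hp).surjective L
    have h1 := DFunLike.congr_fun (mfderivWithin_extChartAt_symm_comp_mfderiv_extChartAt' hp) l
    rw [← hl, (isInvertible_mfderiv_extChartAt hp).inverse_apply_self]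
    exact h1
  -- A codomain independent of the base point allows `φ.symm (φ p)` to be replaced by `p`.
  let g : M → E →L[ℝ] E' := fun q ↦ mfderiv 𝓘(ℝ, E) 𝓘(ℝ, E') f q
  have hq : g (φ.symm (φ p)) = g p := congrArg g (extChartAt_to_inv (I := 𝓘(ℝ, E)) p)
  rw [← hinv]
  exact (DFunLike.congr_fun hq _).symm.trans h'

end Bracket

/-! ### Algebra of the projections. -/

section Projections

variable {E : Type*} [NormedAddCommGroup E] [NormedSpace ℝ E] [FiniteDimensional ℝ E]
  {M : Type*} [TopologicalSpace M] [ChartedSpace E M]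
  [RiemannianBundle (fun x : M ↦ TangentSpace 𝓘(ℝ, E) x)]
  {E' : Type*} [NormedAddCommGroup E'] [NormedSpace ℝ E']
  {N : Type*} [TopologicalSpace N] [ChartedSpace E' N] {F : M → N} {p : M}

theorem hProj_apply (v : TangentSpace 𝓘(ℝ, E) p) :
    hProj E E' F p v = v - vProj E E' F p v := by
  simp [hProj, vProj, Submodule.starProjection_orthogonal]

theorem vProj_mem (v : TangentSpace 𝓘(ℝ, E) p) : vProj E E' F p v ∈ vertical E E' F p :=
  Submodule.starProjection_apply_mem _ _

theorem vProj_eq_self {v : TangentSpace 𝓘(ℝ, E) p} (hv : v ∈ vertical E E' F p) :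
    vProj E E' F p v = v :=
  Submodule.starProjection_eq_self_iff.2 hv

theorem hProj_eq_zero {v : TangentSpace 𝓘(ℝ, E) p} (hv : v ∈ vertical E E' F p) :
    hProj E E' F p v = 0 := by
  rw [hProj_apply, vProj_eq_self hv, sub_self]

theorem inner_hProj_of_mem {v : TangentSpace 𝓘(ℝ, E) p} (hv : v ∈ vertical E E' F p)
    (w : TangentSpace 𝓘(ℝ, E) p) : ⟪v, hProj E E' F p w⟫_ℝ = 0 :=
  (Submodule.mem_orthogonal _ _).1 (Submodule.starProjection_apply_mem _ _) v hv

theorem inner_hProj_left (v w : TangentSpace 𝓘(ℝ, E) p) :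
    ⟪hProj E E' F p v, w⟫_ℝ = ⟪v, hProj E E' F p w⟫_ℝ :=
  Submodule.inner_starProjection_left_eq_right _ v w

theorem inner_vProj_left (v w : TangentSpace 𝓘(ℝ, E) p) :
    ⟪vProj E E' F p v, w⟫_ℝ = ⟪v, vProj E E' F p w⟫_ℝ :=
  Submodule.inner_starProjection_left_eq_right _ v w

variable (E') in
/-- The vertical part `φ_R v = 𝒱 (R v)` of `R v`, for vertical `v`. -/
noncomputable def verticalPart (F : M → N) (R : EndField E M) (p : M) :
    vertical E E' F p →ₗ[ℝ] vertical E E' F p :=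
  ((vProj E E' F p).toLinearMap ∘ₗ (R p).toLinearMap ∘ₗ
    (vertical E E' F p).subtype).codRestrict _ (fun _ ↦ vProj_mem _)

@[simp]
theorem coe_verticalPart (R : EndField E M) (v : vertical E E' F p) :
    (verticalPart E' F R p v : TangentSpace 𝓘(ℝ, E) p) = vProj E E' F p (R p v) := rfl

end Projections

/-! ### Vertical vector fields. -/

section Fields

set_option linter.unusedSectionVars false

variable {E : Type*} [NormedAddCommGroup E] [NormedSpace ℝ E] [FiniteDimensional ℝ E]
  {M : Type*} [TopologicalSpace M] [ChartedSpace E M] [IsManifold 𝓘(ℝ, E) ∞ M]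

/-- `extend` is smooth only near `p`, whereas parallelism of `ω_R` is tested on globally smooth
fields; a bump function supported where `extend` is smooth closes the gap. -/
theorem exists_contMDiff_field_apply_eq [T2Space M] {p : M} (v : TangentSpace 𝓘(ℝ, E) p) :
    ∃ V : Π x : M, TangentSpace 𝓘(ℝ, E) x,
      ContMDiff 𝓘(ℝ, E) (𝓘(ℝ, E).prod 𝓘(ℝ, E)) ∞ (T% V) ∧ V p = v := by
  obtain ⟨s, hs, hsv⟩ := exists_contMDiffOn_extend (k := ∞) 𝓘(ℝ, E) E v
  obtain ⟨f, -, hf⟩ := (SmoothBumpFunction.nhds_basis_tsupport (I := 𝓘(ℝ, E)) p).mem_iff.1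
    (interior_mem_nhds.2 hs)
  refine ⟨(f : M → ℝ) • extend E v, ContMDiffOn.smul_section_of_tsupport f.contMDiff.contMDiffOn
    isOpen_interior hf (hsv.mono interior_subset), ?_⟩
  simp

variable {E' : Type*} [NormedAddCommGroup E'] [NormedSpace ℝ E']
  {N : Type*} [TopologicalSpace N] [ChartedSpace E' N] [IsManifold 𝓘(ℝ, E') ∞ N] {F : M → N}

/-- Composing `F` with a chart of `N` makes the target a vector space; the chart's derivative is
injective, so near `p` the kernel is unchanged. -/
theorem mlieBracket_mem_vertical (hF : ContMDiff 𝓘(ℝ, E) 𝓘(ℝ, E') ∞ F)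
    {V W : Π x : M, TangentSpace 𝓘(ℝ, E) x} {p : M}
    (hV : MDiffAt (T% V) p) (hW : MDiffAt (T% W) p)
    (hVv : ∀ x, V x ∈ vertical E E' F x) (hWv : ∀ x, W x ∈ vertical E E' F x) :
    VectorField.mlieBracket 𝓘(ℝ, E) V W p ∈ vertical E E' F p := by
  set ψ := extChartAt 𝓘(ℝ, E') (F p)
  have hψF : ContMDiffAt 𝓘(ℝ, E) 𝓘(ℝ, E') ∞ (ψ ∘ F) p := contMDiffAt_extChartAt.comp p (hF p)
  have hsrc : ∀ᶠ x in 𝓝 p, F x ∈ ψ.source :=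
    hF.continuous.continuousAt.preimage_mem_nhds (extChartAt_source_mem_nhds (F p))
  have hcomp {x : M} (hx : F x ∈ ψ.source) : mfderiv 𝓘(ℝ, E) 𝓘(ℝ, E') (ψ ∘ F) x =
      (mfderiv 𝓘(ℝ, E') 𝓘(ℝ, E') ψ (F x)).comp (mfderiv 𝓘(ℝ, E) 𝓘(ℝ, E') F x) :=
    mfderiv_comp x (mdifferentiableAt_extChartAt (by simpa [ψ] using hx))
      ((hF x).mdifferentiableAt (by simp))
  have hzero {U : Π x : M, TangentSpace 𝓘(ℝ, E) x} (hU : ∀ x, U x ∈ vertical E E' F x) :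
      ∀ᶠ x in 𝓝 p, mfderiv 𝓘(ℝ, E) 𝓘(ℝ, E') (ψ ∘ F) x (U x) = 0 := by
    filter_upwards [hsrc] with x hx
    have h : mfderiv 𝓘(ℝ, E) 𝓘(ℝ, E') F x (U x) = 0 := hU x
    rw [hcomp hx, ContinuousLinearMap.comp_apply, h, map_zero]
  have h := mfderiv_mlieBracket_eq_zero (hψF.of_le (WithTop.coe_le_coe.2 (le_top : (2 : ℕ∞) ≤ ⊤))) hV hW (hzero hVv) (hzero hWv)
  rw [hcomp hsrc.self_of_nhds, ContinuousLinearMap.comp_apply] at h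
  exact (isInvertible_mfderiv_extChartAt hsrc.self_of_nhds).injective (h.trans (map_zero _).symm)

variable [RiemannianBundle (fun x : M ↦ TangentSpace 𝓘(ℝ, E) x)]

variable [IsContMDiffRiemannianBundle 𝓘(ℝ, E) ∞ E (fun x : M ↦ TangentSpace 𝓘(ℝ, E) x)]
  [FiniteDimensional ℝ E']

theorem contMDiffAt_hProj (hF : ContMDiff 𝓘(ℝ, E) 𝓘(ℝ, E') ∞ F)
    (hsurj : ∀ p, Function.Surjective (mfderiv 𝓘(ℝ, E) 𝓘(ℝ, E') F p))
    {Y : Π x : M, TangentSpace 𝓘(ℝ, E) x} {p : M}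
    (hY : ContMDiffAt 𝓘(ℝ, E) (𝓘(ℝ, E).prod 𝓘(ℝ, E)) ∞ (T% Y) p) :
    ContMDiffAt 𝓘(ℝ, E) (𝓘(ℝ, E).prod 𝓘(ℝ, E)) ∞ (T% (fun x ↦ hProj E E' F x (Y x))) p := by
  simp only [hProj_apply]
  exact hY.sub_section (contMDiffAt_vProj hF hsurj hY)

/-- Every vertical vector is the value of a smooth vertical field. -/
theorem exists_isVerticalField [T2Space M] (hF : ContMDiff 𝓘(ℝ, E) 𝓘(ℝ, E') ∞ F)
    (hsurj : ∀ p, Function.Surjective (mfderiv 𝓘(ℝ, E) 𝓘(ℝ, E') F p))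
    {p : M} {v : TangentSpace 𝓘(ℝ, E) p} (hv : v ∈ vertical E E' F p) :
    ∃ V : Π x : M, TangentSpace 𝓘(ℝ, E) x, IsVerticalField E' F V ∧ V p = v := by
  obtain ⟨Y, hY, hYp⟩ := exists_contMDiff_field_apply_eq v
  refine ⟨fun x ↦ vProj E E' F x (Y x), ⟨fun x ↦ contMDiffAt_vProj hF hsurj (hY x),
    fun x ↦ Submodule.starProjection_apply_mem _ _⟩, ?_⟩
  change vProj E E' F p (Y p) = v
  rw [hYp]
  exact Submodule.starProjection_eq_self_iff.2 hv

end Fields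

/-! ### The second fundamental form of the fibers. -/

section SecondForm

set_option linter.unusedSectionVars false

variable {E : Type*} [NormedAddCommGroup E] [NormedSpace ℝ E] [FiniteDimensional ℝ E]
  {M : Type*} [TopologicalSpace M] [ChartedSpace E M] [IsManifold 𝓘(ℝ, E) ∞ M]
  [RiemannianBundle (fun x : M ↦ TangentSpace 𝓘(ℝ, E) x)]
  [IsContMDiffRiemannianBundle 𝓘(ℝ, E) ∞ E (fun x : M ↦ TangentSpace 𝓘(ℝ, E) x)]

theorem inner_leviCivita_eq_neg {Y Z : Π x : M, TangentSpace 𝓘(ℝ, E) x} {p : M}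
    (hY : MDiffAt (T% Y) p) (hZ : MDiffAt (T% Z) p) (h : ∀ x, ⟪Y x, Z x⟫_ℝ = 0)
    (v : TangentSpace 𝓘(ℝ, E) p) :
    ⟪leviCivita E M Y p v, Z p⟫_ℝ = -⟪Y p, leviCivita E M Z p v⟫_ℝ := by
  have h1 := leviCivita_metric (mdifferentiableAt_extend 𝓘(ℝ, E) E v) hY hZ
  simp only [h, extend_apply_self] at h1
  rw [mvfderiv_const] at h1
  exact eq_neg_of_add_eq_zero_left h1.symm

variable {E' : Type*} [NormedAddCommGroup E'] [NormedSpace ℝ E']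
  {N : Type*} [TopologicalSpace N] [ChartedSpace E' N] {F : M → N} {p : M}

variable (E E') in
/-- The derivative of the horizontal part of an extension of `z`. -/
noncomputable def horizontalDeriv (F : M → N) (p : M) (z : TangentSpace 𝓘(ℝ, E) p) :
    TangentSpace 𝓘(ℝ, E) p →L[ℝ] TangentSpace 𝓘(ℝ, E) p :=
  leviCivita E M (fun x ↦ hProj E E' F x (extend E z x)) p

variable [IsManifold 𝓘(ℝ, E') ∞ N] [FiniteDimensional ℝ E']
  (hF : ContMDiff 𝓘(ℝ, E) 𝓘(ℝ, E') ∞ F)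
  (hsurj : ∀ p, Function.Surjective (mfderiv 𝓘(ℝ, E) 𝓘(ℝ, E') F p))

include hF hsurj

theorem mdifferentiableAt_vProj_extend (v : TangentSpace 𝓘(ℝ, E) p) :
    MDiffAt (T% (fun x ↦ vProj E E' F x (extend E v x))) p :=
  (contMDiffAt_vProj hF hsurj (contMDiffAt_extend 𝓘(ℝ, E) E v)).mdifferentiableAt (by simp)

theorem mdifferentiableAt_hProj_extend (v : TangentSpace 𝓘(ℝ, E) p) :
    MDiffAt (T% (fun x ↦ hProj E E' F x (extend E v x))) p :=
  (contMDiffAt_hProj hF hsurj (contMDiffAt_extend 𝓘(ℝ, E) E v)).mdifferentiableAt (by simp)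

/-- The right-hand side involves `W` only through `W p`; this is what makes the second fundamental
form independent of the vertical extension. -/
theorem inner_hProj_leviCivita {W : Π x : M, TangentSpace 𝓘(ℝ, E) x}
    (hW : MDiffAt (T% W) p) (hWv : ∀ x, W x ∈ vertical E E' F x)
    (v z : TangentSpace 𝓘(ℝ, E) p) :
    ⟪hProj E E' F p (leviCivita E M W p v), z⟫_ℝ = -⟪W p, horizontalDeriv E E' F p z v⟫_ℝ := by
  have h := inner_leviCivita_eq_neg hW (mdifferentiableAt_hProj_extend hF hsurj z)
    (fun x ↦ inner_hProj_of_mem (hWv x) _) v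
  rw [extend_apply_self] at h
  rw [inner_hProj_left, h, horizontalDeriv]

theorem inner_fiberSecondFundamentalForm (v w : vertical E E' F p)
    (z : TangentSpace 𝓘(ℝ, E) p) :
    ⟪fiberSecondFundamentalForm E E' F p v w, z⟫_ℝ
      = -⟪(w : TangentSpace 𝓘(ℝ, E) p), horizontalDeriv E E' F p z v⟫_ℝ := by
  have h1 := inner_hProj_leviCivita hF hsurj
    (mdifferentiableAt_vProj_extend hF hsurj (w : TangentSpace 𝓘(ℝ, E) p))
    (fun x ↦ vProj_mem _) v z
  -- The other summand of O'Neill's tensor vanishes: paired with a vertical field, the derivative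
  -- falls on that field, and the horizontal part of the extension of `w` is zero at `p`.
  have h2 : vProj E E' F p (leviCivita E M
      (fun x ↦ hProj E E' F x (extend E (w : TangentSpace 𝓘(ℝ, E) p) x)) p v) = 0 := by
    refine ext_inner_right ℝ fun u ↦ ?_
    have h := inner_leviCivita_eq_neg
      (mdifferentiableAt_hProj_extend hF hsurj (w : TangentSpace 𝓘(ℝ, E) p))
      (mdifferentiableAt_vProj_extend hF hsurj u)
      (fun x ↦ by rw [real_inner_comm]; exact inner_hProj_of_mem (vProj_mem _) _) v
    rw [extend_apply_self, extend_apply_self, hProj_eq_zero w.2, inner_zero_left, neg_zero] at h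
    rw [inner_vProj_left, h, inner_zero_left]
  rw [extend_apply_self, vProj_eq_self w.2] at h1
  rw [fiberSecondFundamentalForm, oneillT, extend_apply_self, vProj_eq_self v.2, h2, add_zero, h1]

theorem hProj_leviCivita_eq {W : Π x : M, TangentSpace 𝓘(ℝ, E) x}
    (hW : MDiffAt (T% W) p) (hWv : ∀ x, W x ∈ vertical E E' F x) (v : vertical E E' F p) :
    hProj E E' F p (leviCivita E M W p v)
      = fiberSecondFundamentalForm E E' F p v ⟨W p, hWv p⟩ := by
  refine ext_inner_right ℝ fun z ↦ ?_
  rw [inner_hProj_leviCivita hF hsurj hW hWv, inner_fiberSecondFundamentalForm hF hsurj]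

/-- By torsion-freeness the difference of the two sides is the horizontal part of a bracket of
vertical fields. -/
theorem fiberSecondFundamentalForm_symm (v w : vertical E E' F p) :
    fiberSecondFundamentalForm E E' F p v w = fiberSecondFundamentalForm E E' F p w v := by
  have key (u : vertical E E' F p) : ∃ U : Π x : M, TangentSpace 𝓘(ℝ, E) x,
      MDiffAt (T% U) p ∧ (∀ x, U x ∈ vertical E E' F x) ∧ U p = u :=
    ⟨_, mdifferentiableAt_vProj_extend hF hsurj (u : TangentSpace 𝓘(ℝ, E) p),
      fun x ↦ vProj_mem _, by rw [extend_apply_self, vProj_eq_self u.2]⟩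
  obtain ⟨V, hV, hVv, hVp⟩ := key v
  obtain ⟨W, hW, hWv, hWp⟩ := key w
  obtain rfl : v = ⟨V p, hVv p⟩ := Subtype.ext hVp.symm
  obtain rfl : w = ⟨W p, hWv p⟩ := Subtype.ext hWp.symm
  rw [← hProj_leviCivita_eq hF hsurj hW hWv, ← hProj_leviCivita_eq hF hsurj hV hVv,
    ← sub_eq_zero, ← map_sub, leviCivita_torsion_free hV hW]
  exact hProj_eq_zero (mlieBracket_mem_vertical hF hV hW hVv hWv)

omit hF hsurj in
theorem IsAlmostHermitian.contMDiffAt_apply {R : EndField E M} (hR : IsAlmostHermitian R)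
    {Y : Π x : M, TangentSpace 𝓘(ℝ, E) x}
    (hY : ContMDiffAt 𝓘(ℝ, E) (𝓘(ℝ, E).prod 𝓘(ℝ, E)) ∞ (T% Y) p) :
    ContMDiffAt 𝓘(ℝ, E) (𝓘(ℝ, E).prod 𝓘(ℝ, E)) ∞ (T% (fun x ↦ R x (Y x))) p :=
  ContMDiffAt.clm_bundle_apply (hR.smooth p) hY

/-- If `ω_R` is parallel, then `𝒯_v (φ_R w) = ℋ R (𝒯_v w)`. -/
theorem IsOmegaParallel.fiberSecondFundamentalForm_verticalPart [T2Space M] {R : EndField E M}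
    (hR : IsAlmostHermitian R) (hRp : IsParallelEndField R) (hω : IsOmegaParallel E' F R)
    (v w : vertical E E' F p) :
    fiberSecondFundamentalForm E E' F p v (verticalPart E' F R p w)
      = hProj E E' F p (R p (fiberSecondFundamentalForm E E' F p v w)) := by
  obtain ⟨V, hV, hVp⟩ := exists_isVerticalField hF hsurj v.2
  obtain ⟨W, hW, hWp⟩ := exists_isVerticalField hF hsurj w.2
  obtain rfl : v = ⟨V p, hV.mem_vertical p⟩ := Subtype.ext hVp.symm
  obtain rfl : w = ⟨W p, hW.mem_vertical p⟩ := Subtype.ext hWp.symm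
  have hWd : MDiffAt (T% W) p := (hW.smooth p).mdifferentiableAt (by simp)
  have hRW := hR.contMDiffAt_apply (hW.smooth p)
  have hφ : MDiffAt (T% (fun x ↦ vProj E E' F x (R x (W x)))) p :=
    (contMDiffAt_vProj hF hsurj hRW).mdifferentiableAt (by simp)
  have hω' : MDiffAt (T% (fun x ↦ omega E' F R x (W x))) p :=
    (contMDiffAt_hProj hF hsurj hRW).mdifferentiableAt (by simp)
  have hsum : (fun x ↦ R x (W x)) =
      (fun x ↦ vProj E E' F x (R x (W x))) + fun x ↦ omega E' F R x (W x) := by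
    funext x
    simp [omega, hProj_apply]
  have h1 := hRp W p hWd (V p)
  rw [hsum, (leviCivita E M).isCovariantDerivativeOnUniv.add hφ hω'] at h1
  have h2 := congrArg (hProj E E' F p) h1
  rw [add_apply, map_add, hProj_leviCivita_eq hF hsurj hφ (fun x ↦ vProj_mem _)
    ⟨V p, hV.mem_vertical p⟩] at h2
  -- Parallelism replaces `ℋ ∇_V (ω W)` by `ω (𝒱 ∇_V W)`, which cancels the contribution of `𝒱 ∇_V
  -- W` to `ℋ R ∇_V W`.
  have h3 := hω V W hV hW p
  rw [nablaOmega, sub_eq_zero] at h3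
  rw [h3, omega] at h2
  rw [← hProj_leviCivita_eq hF hsurj hWd hW.mem_vertical, hProj_apply (leviCivita E M W p _),
    map_sub, map_sub, ← h2]
  exact (add_sub_cancel_right _ _).symm

end SecondForm

/-! ### The slant condition on the vertical part of `R`. -/

section Slant

set_option linter.unusedSectionVars false

variable {E : Type*} [NormedAddCommGroup E] [NormedSpace ℝ E] [FiniteDimensional ℝ E]
  {M : Type*} [TopologicalSpace M] [ChartedSpace E M] [IsManifold 𝓘(ℝ, E) ∞ M]
  [RiemannianBundle (fun x : M ↦ TangentSpace 𝓘(ℝ, E) x)]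
  {E' : Type*} [NormedAddCommGroup E'] [NormedSpace ℝ E']
  {N : Type*} [TopologicalSpace N] [ChartedSpace E' N] {F : M → N} {p : M}

theorem HasSlantAngle.norm_verticalPart {R : EndField E M} (hR : IsAlmostHermitian R) {θ : ℝ}
    (hθ : HasSlantAngle E E' F R θ) (hθ_lt : θ < Real.pi / 2) (v : vertical E E' F p) :
    ‖verticalPart E' F R p v‖ = Real.cos θ * ‖v‖ := by
  change ‖vProj E E' F p (R p v)‖ = Real.cos θ * ‖(v : TangentSpace 𝓘(ℝ, E) p)‖
  by_cases hv : (v : TangentSpace 𝓘(ℝ, E) p) = 0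
  · simp [hv]
  have hang := hθ p v v.2 hv
  -- The angle with the zero vector is `π / 2` by convention, which `θ < π / 2` excludes.
  have hb : ‖vProj E E' F p (R p v)‖ ≠ 0 := by
    intro h
    rw [norm_eq_zero.1 h, InnerProductGeometry.angle_zero_right] at hang
    exact hθ_lt.ne' hang
  have hcos := InnerProductGeometry.cos_angle_mul_norm_mul_norm (R p v)
    (vProj E E' F p (R p v))
  have hinner : ⟪R p v, vProj E E' F p (R p v)⟫_ℝ = ‖vProj E E' F p (R p v)‖ ^ 2 := by
    rw [← real_inner_self_eq_norm_sq, inner_vProj_left, vProj_eq_self (vProj_mem _)]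
  have hnorm : ‖R p v‖ = ‖(v : TangentSpace 𝓘(ℝ, E) p)‖ := by
    rw [norm_eq_sqrt_real_inner, hR.inner_eq, ← norm_eq_sqrt_real_inner]
  rw [hang, hinner, hnorm, pow_two, ← mul_assoc] at hcos
  exact (mul_right_cancel₀ hb hcos).symm

/-- Polarization of the norm identity. -/
theorem HasSlantAngle.inner_verticalPart {R : EndField E M} (hR : IsAlmostHermitian R) {θ : ℝ}
    (hθ : HasSlantAngle E E' F R θ) (hθ_lt : θ < Real.pi / 2) (v w : vertical E E' F p) :
    ⟪verticalPart E' F R p v, verticalPart E' F R p w⟫_ℝ = Real.cos θ ^ 2 * ⟪v, w⟫_ℝ := by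
  have h := norm_add_sq_real (verticalPart E' F R p v) (verticalPart E' F R p w)
  have h' := norm_add_sq_real v w
  rw [← map_add, hθ.norm_verticalPart hR hθ_lt, hθ.norm_verticalPart hR hθ_lt,
    hθ.norm_verticalPart hR hθ_lt] at h
  linear_combination (-1 / 2 : ℝ) * h + (Real.cos θ ^ 2 / 2) * h'

/-- An isometry with square `-1` is skew-adjoint, and so is its vertical part `φ`; hence `⟪φ²v, w⟫ =
-⟪φ v, φ w⟫`. -/
theorem HasSlantAngle.verticalPart_verticalPart {R : EndField E M} (hR : IsAlmostHermitian R)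
    {θ : ℝ} (hθ : HasSlantAngle E E' F R θ) (hθ_lt : θ < Real.pi / 2) (v : vertical E E' F p) :
    verticalPart E' F R p (verticalPart E' F R p v) = -(Real.cos θ ^ 2) • v := by
  refine ext_inner_right ℝ fun w ↦ ?_
  have hadj (x y : TangentSpace 𝓘(ℝ, E) p) : ⟪R p x, y⟫_ℝ = -⟪x, R p y⟫_ℝ := by
    rw [← hR.inner_eq p (R p x), hR.sq_eq_neg, inner_neg_left]
  have h1 : ⟪verticalPart E' F R p (verticalPart E' F R p v), w⟫_ℝ =
      -⟪verticalPart E' F R p v, verticalPart E' F R p w⟫_ℝ := by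
    simp only [Submodule.coe_inner, coe_verticalPart]
    rw [inner_vProj_left, vProj_eq_self w.2, hadj, ← inner_vProj_left _ (R p w),
      vProj_eq_self (vProj_mem _)]
  rw [h1, hθ.inner_verticalPart hR hθ_lt, ← neg_mul]
  exact (real_inner_smul_left _ _ _).symm

end Slant

/-! ### A trace that equals its own negative. -/

section Trace

/-- If a linear map `J` scales norms by `c > 0` and changes the quadratic form of `A` by the factor
`-c ^ 2`, then `A` is trace free. -/
theorem sum_inner_eq_zero_of_norm_map {V : Type*} [NormedAddCommGroup V] [InnerProductSpace ℝ V]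
    [FiniteDimensional ℝ V] {ι : Type*} [Fintype ι] (b : OrthonormalBasis ι ℝ V) {c : ℝ}
    (hc : 0 < c) (A J : V →ₗ[ℝ] V) (hJ : ∀ v, ‖J v‖ = c * ‖v‖)
    (hA : ∀ v, ⟪J v, A (J v)⟫_ℝ = -c ^ 2 * ⟪v, A v⟫_ℝ) :
    ∑ i, ⟪b i, A (b i)⟫_ℝ = 0 := by
  -- The rescaled map carries `b` to another orthonormal basis, and the trace of `A` can be computed
  -- in either.
  let L : V →ₗᵢ[ℝ] V := ⟨c⁻¹ • J, fun v ↦ by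
    rw [LinearMap.smul_apply, norm_smul, hJ, norm_inv, Real.norm_of_nonneg hc.le,
      inv_mul_cancel_left₀ hc.ne']⟩
  have h := (A.trace_eq_sum_inner b).symm.trans
    (A.trace_eq_sum_inner (b.map (L.toLinearIsometryEquiv rfl)))
  have hL (v : V) : ⟪L v, A (L v)⟫_ℝ = -⟪v, A v⟫_ℝ := by
    change ⟪c⁻¹ • J v, A (c⁻¹ • J v)⟫_ℝ = _
    rw [map_smul, real_inner_smul_left, real_inner_smul_right, hA]
    field_simp
  simp only [OrthonormalBasis.map_apply, LinearIsometry.toLinearIsometryEquiv_apply, hL,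
    Finset.sum_neg_distrib] at h
  exact self_eq_neg.1 h

end Trace

end HConformalSlant

/-! ### Minimality of the fibers. -/

theorem theorem3p7
    {E : Type*} [NormedAddCommGroup E] [NormedSpace ℝ E] [FiniteDimensional ℝ E]
    {M : Type*} [TopologicalSpace M] [T2Space M] [ChartedSpace E M] [IsManifold 𝓘(ℝ, E) ∞ M]
    [RiemannianBundle (fun x : M ↦ TangentSpace 𝓘(ℝ, E) x)]
    [IsContMDiffRiemannianBundle 𝓘(ℝ, E) ∞ E (fun x : M ↦ TangentSpace 𝓘(ℝ, E) x)]
    {E' : Type*} [NormedAddCommGroup E'] [NormedSpace ℝ E'] [FiniteDimensional ℝ E']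
    {N : Type*} [TopologicalSpace N] [T2Space N] [ChartedSpace E' N] [IsManifold 𝓘(ℝ, E') ∞ N]
    [RiemannianBundle (fun x : N ↦ TangentSpace 𝓘(ℝ, E') x)]
    [IsContMDiffRiemannianBundle 𝓘(ℝ, E') ∞ E' (fun x : N ↦ TangentSpace 𝓘(ℝ, E') x)]
    (S : HyperkahlerStructure E M) (F : M → N) (hF : IsAlmostHConformalSlant E' S F)
    (R : EndField E M) (hR : R ∈ S.basis) (hparallel : IsOmegaParallel E' F R)
    (θ : ℝ) (hθ : HasSlantAngle E E' F R θ) (hθ_nonneg : 0 ≤ θ) (hθ_lt : θ < Real.pi / 2) :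
    ∀ q : N, IsMinimalFiber E E' F q := by
  intro q p _
  have hsm := hF.horizontallyConformal.smooth
  have hsurj := hF.horizontallyConformal.surjective
  have hH := S.hermitian R hR
  have hcos : 0 < Real.cos θ := Real.cos_pos_of_mem_Ioo ⟨by linarith [Real.pi_pos], hθ_lt⟩
  have hform (v : vertical E E' F p) :
      fiberSecondFundamentalForm E E' F p (verticalPart E' F R p v) (verticalPart E' F R p v)
        = fiberSecondFundamentalForm E E' F p v (-(Real.cos θ ^ 2) • v) := by
    have h := hparallel.fiberSecondFundamentalForm_verticalPart hsm hsurj hH (S.parallel R hR)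
      (p := p)
    rw [h, fiberSecondFundamentalForm_symm hsm hsurj, ← h,
      hθ.verticalPart_verticalPart hH hθ_lt]
  rw [fiberMeanCurvature]
  refine smul_eq_zero_of_right _ (ext_inner_right ℝ fun z ↦ ?_)
  rw [sum_inner, inner_zero_left]
  -- The shape operator in the direction of the horizontal part of `z`: it turns the `z`-component
  -- of the vector-valued trace into the trace of an endomorphism.
  let A : vertical E E' F p →ₗ[ℝ] vertical E E' F p :=
    -((vertical E E' F p).orthogonalProjectionOnto.toLinearMap ∘ₗ
      (horizontalDeriv E E' F p z).toLinearMap ∘ₗ (vertical E E' F p).subtype)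
  have hA (v w : vertical E E' F p) :
      ⟪fiberSecondFundamentalForm E E' F p v w, z⟫_ℝ = ⟪w, A v⟫_ℝ := by
    rw [inner_fiberSecondFundamentalForm hsm hsurj]
    simp [A]
  simp only [hA]
  refine sum_inner_eq_zero_of_norm_map _ hcos A (verticalPart E' F R p)
    (hθ.norm_verticalPart hH hθ_lt) fun v ↦ ?_
  rw [← hA, hform, hA]
  exact real_inner_smul_left v (A v) _
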